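/- Let $G$ be a locally compact (Hausdorff) group with left Haar measure $dx$, and let $w : G \to (0,\infty)$ be a weight, i.e. a Borel measurable function with $w(xy) \le w(x)w(y)$ for all $x,y \in G$. Assume that either $w$ is constant on the conjugacy classes of $G$, or $w(x) \ge 1$ for all $x \in G$. Let $A$ be a complex Banach algebra (not necessarily unital) with center $\mathcal{Z}(A)$, and assume that $A$ has a bounded $\mathcal{Z}(A)$-approximate identity, i.e. a bounded net $(a_\alpha)$ in $A$ such that $a_\alpha a \to a$ for every $a \in \mathcal{Z}(A)$. Let $L^1_w(G,A)$ be the Banach algebra of (a.e.-classes of) measurable functions $f : G \to A$ with $\int_G \|f(x)\|\,w(x)\,dx < \infty$, with multiplication $(f*g)(x) = \int_G f(xy)\,g(y^{-1})\,dy$, and let $\mathcal{Z}(L^1_w(G,A))$ be its center. If $\mathcal{Z}(L^1_w(G,A)) \neq \{0\}$, then $G$ is an $[\mathrm{IN}]$ group, i.e. the identity of $G$ has a compact neighbourhood that is invariant under all inner automorphisms of $G$. -/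

import Mathlib

open MeasureTheory Filter Topology

/-- A weight on `G`: a Borel measurable, strictly positive, submultiplicative function. -/
structure IsWeight {G : Type*} [Group G] [MeasurableSpace G] (w : G → ℝ) : Prop where
  measurable : Measurable w
  pos : ∀ x, 0 < w x
  mul_le : ∀ x y, w (x * y) ≤ w x * w y

/-- The measure `w dx`. -/
noncomputable def weightedMeasure {G : Type*} [MeasurableSpace G] (μ : Measure G) (w : G → ℝ) :
    Measure G :=
  μ.withDensity (fun x => ENNReal.ofReal (w x))

/-- The space `L¹_w(G, A)`: classes, modulo equality almost everywhere, of (strongly) measurable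
functions `f : G → A` with `∫ ‖f x‖ w x dx < ∞`. -/
noncomputable abbrev BeurlingSpace {G : Type*} [MeasurableSpace G] (μ : Measure G) (w : G → ℝ)
    (A : Type*) [NormedAddCommGroup A] :=
  Lp A 1 (weightedMeasure μ w)

/-- The convolution `(f * g)(x) = ∫ f (x y) g (y⁻¹) dy`, the multiplication of `L¹_w(G, A)`. -/
noncomputable def beurlingConv {G : Type*} [Group G] [MeasurableSpace G] (μ : Measure G)
    {A : Type*} [NonUnitalNormedRing A] [NormedSpace ℂ A] (f g : G → A) : G → A :=
  fun x => ∫ y, f (x * y) * g y⁻¹ ∂μ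

/-- The center of `L¹_w(G, A)`: the elements that commute with every element under convolution.
The two products are compared as elements of `L¹_w(G, A)`, that is, almost everywhere. -/
def beurlingCenter {G : Type*} [Group G] [MeasurableSpace G] (μ : Measure G) (w : G → ℝ)
    (A : Type*) [NonUnitalNormedRing A] [NormedSpace ℂ A] : Set (BeurlingSpace μ w A) :=
  {f | ∀ g : BeurlingSpace μ w A,
    beurlingConv μ (f : G → A) (g : G → A) =ᵐ[weightedMeasure μ w]
      beurlingConv μ (g : G → A) (f : G → A)}

/-- A bounded `Z(A)`-approximate identity: a bounded net `a` in `A` with `a i * z → z` for every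
`z` in the center of `A`. -/
def IsBoundedCenterApproxIdentity {A : Type*} [NonUnitalNormedRing A]
    {ι : Type*} [Preorder ι] (a : ι → A) : Prop :=
  (∃ M : ℝ, ∀ i, ‖a i‖ ≤ M) ∧ ∀ z ∈ Set.center A, Tendsto (fun i => a i * z) atTop (𝓝 z)

/-- `G` is an [IN] group: the identity has a compact neighbourhood which is invariant under all
inner automorphisms. -/
def IsINGroup (G : Type*) [Group G] [TopologicalSpace G] : Prop :=
  ∃ K : Set G, K ∈ 𝓝 (1 : G) ∧ IsCompact K ∧ ∀ g : G, (fun x => g * x * g⁻¹) '' K = K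

/-! Let `f ≠ 0` be central. Commuting with `φ ⊗ a`, for `φ` continuous with compact support, says
that two continuous functions agree a.e., hence everywhere. Evaluated suitably, this gives `∫ ψ(y)
f(y)a dy = ∫ ψ(tyt⁻¹) a f(y) dμ.inv`. Comparing this identity at `t` with the one at `1` shows that
the vector measure `f(y)a dy` is invariant under conjugation, so `f(tyt⁻¹)a = c f(y)a` a.e., where
`c` is the factor by which conjugation by `t` scales Haar measure
(`exists_conj_ae_eq_smul_of_mem_beurlingCenter`).

Some `a` has `f a ≠ 0`: otherwise `a f = 0` for all `a` as well, every set integral `z` of `f`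
annihilates `A` on both sides and is central, and the approximate identity forces `z = 0`.

Taking norms, with the factor `w` if it is a class function, yields a nonzero real `h ∈ L¹(G)` that
conjugations multiply by constants. Then `x ↦ ‖h - h(x⁻¹ ·)‖₁` is a class function, small near `1`
and close to `2‖h‖₁` off a compact set. Its sublevel set at `‖h‖₁` is thus an invariant, relatively
compact neighbourhood of `1` (`isINGroup_of_integrable_conj`). -/

/-! ### Approximation by continuous compactly supported functions. -/

section TestFunctions

variable {X : Type*} [TopologicalSpace X] [LocallyCompactSpace X] [T2Space X] [MeasurableSpace X]
    [BorelSpace X] {μ : Measure X} [μ.Regular]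

/-- A measurable set of finite measure agrees with a continuous compactly supported function
outside a set of small measure. -/
theorem exists_hasCompactSupport_eq_indicator_off_small {s : Set X} (hs : MeasurableSet s)
    (hμs : μ s ≠ ⊤) {δ : ENNReal} (hδ : δ ≠ 0) :
    ∃ (ψ : C(X, ℝ)) (T : Set X), HasCompactSupport ψ ∧ (∀ y, ψ y ∈ Set.Icc (0 : ℝ) 1) ∧
      MeasurableSet T ∧ μ T < δ ∧ ∀ y ∉ T, ψ y = s.indicator 1 y := by
  obtain ⟨δ', hδ', hδδ'⟩ : ∃ δ' : ENNReal, δ' ≠ 0 ∧ δ' + δ' ≤ δ :=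
    ⟨δ / 2, (ENNReal.half_pos hδ).ne', (ENNReal.add_halves δ).le⟩
  obtain ⟨U, hsU, hU, -, hUs⟩ := hs.exists_isOpen_sdiff_lt hμs hδ'
  obtain ⟨K, hKs, hK, hsK⟩ := hs.exists_isCompact_sdiff_lt hμs hδ'
  obtain ⟨ψ, hψK, hψc, hψU, hψ⟩ :=
    exists_continuousMap_one_of_isCompact_subset_isOpen hK hU (hKs.trans hsU)
  refine ⟨ψ, U \ K, hψc, hψ, hU.measurableSet.diff hK.measurableSet, ?_, fun y hy => ?_⟩
  · calc μ (U \ K) ≤ μ ((U \ s) ∪ (s \ K)) := measure_mono fun x hx => by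
          by_cases h : x ∈ s
          · exact Or.inr ⟨h, hx.2⟩
          · exact Or.inl ⟨hx.1, h⟩
      _ ≤ μ (U \ s) + μ (s \ K) := measure_union_le _ _
      _ < δ' + δ' := ENNReal.add_lt_add hUs hsK
      _ ≤ δ := hδδ'
  · by_cases hyK : y ∈ K
    · have : ψ y = 1 := hψK hyK
      simp [this, hKs hyK]
    · have hyU : y ∉ U := fun h => hy ⟨h, hyK⟩
      have : ψ y = 0 := image_eq_zero_of_notMem_tsupport fun h => hyU (hψU h)
      have hys : y ∉ s := fun h => hyU (hsU h)
      simp [this, hys]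

/-- An integrable function which integrates to zero against all continuous compactly supported
functions vanishes almost everywhere. -/
theorem ae_eq_zero_of_integral_hasCompactSupport_smul
    {E : Type*} [NormedAddCommGroup E] [NormedSpace ℝ E] [CompleteSpace E] {F : X → E}
    (hF : Integrable F μ)
    (h : ∀ ψ : X → ℝ, Continuous ψ → HasCompactSupport ψ → ∫ y, ψ y • F y ∂μ = 0) :
    F =ᵐ[μ] 0 := by
  refine hF.ae_eq_zero_of_forall_setIntegral_eq_zero fun s hs hμs => ?_
  rw [← norm_eq_zero]
  refine le_antisymm (le_of_forall_pos_le_add fun ε hε => ?_) (norm_nonneg _)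
  -- Absolute continuity of the integral: the error of replacing the indicator of `s` by `ψ` lives
  -- on `T` and is at most `‖F‖` there.
  obtain ⟨δ, hδ, hsmall⟩ := exists_pos_setLIntegral_lt_of_measure_lt
    hF.2.ne (ENNReal.ofReal_pos.2 hε).ne'
  obtain ⟨ψ, T, hψc, hψ, hTm, hT, hψT⟩ :=
    exists_hasCompactSupport_eq_indicator_off_small hs hμs.ne hδ.ne'
  have hψF : Integrable (fun y => ψ y • F y) μ :=
    hF.bdd_smul 1 ψ.continuous.measurable.aestronglyMeasurable (.of_forall fun y => by
      rw [Real.norm_eq_abs, abs_of_nonneg (hψ y).1]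
      exact (hψ y).2)
  rw [zero_add, ← sub_zero (∫ x in s, F x ∂μ), ← h ψ ψ.continuous hψc, ← integral_indicator hs,
    ← integral_sub (hF.indicator hs) hψF]
  calc ‖∫ y, (s.indicator F y - ψ y • F y) ∂μ‖
      ≤ ∫ y in T, ‖F y‖ ∂μ := by
        rw [← integral_indicator hTm]
        refine norm_integral_le_of_norm_le (hF.norm.indicator hTm) (.of_forall fun y => ?_)
        by_cases hyT : y ∈ T
        · have h1 := (hψ y).1
          have h2 := (hψ y).2
          rw [Set.indicator_of_mem hyT]
          by_cases hys : y ∈ s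
          · have : F y - ψ y • F y = (1 - ψ y) • F y := by rw [sub_smul, one_smul]
            rw [Set.indicator_of_mem hys, this, norm_smul, Real.norm_eq_abs,
              abs_of_nonneg (by linarith)]
            exact mul_le_of_le_one_left (norm_nonneg _) (by linarith)
          · rw [Set.indicator_of_notMem hys, zero_sub, norm_neg, norm_smul, Real.norm_eq_abs,
              abs_of_nonneg h1]
            exact mul_le_of_le_one_left (norm_nonneg _) h2
        · rw [hψT y hyT]
          by_cases hys : y ∈ s <;> simp [hys, hyT]
    _ ≤ ε := by
        rw [integral_norm_eq_lintegral_enorm hF.1.restrict]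
        exact ENNReal.toReal_le_of_le_ofReal hε.le (hsmall _ hT).le

/-- Continuous compactly supported functions are dense in `L¹` of a regular measure. -/
theorem exists_hasCompactSupport_integral_abs_sub_le {h : X → ℝ} (hh : Integrable h μ) {ε : ℝ}
    (hε : 0 < ε) : ∃ k : X → ℝ, HasCompactSupport k ∧ ∫ x, |h x - k x| ∂μ ≤ ε ∧ Continuous k := by
  have : ∃ k : X → ℝ, eLpNorm (h - k) 1 μ ≤ ENNReal.ofReal ε ∧ Continuous k ∧
      HasCompactSupport k := by
    refine (memLp_one_iff_integrable.2 hh).induction_dense ENNReal.one_ne_top _ ?_ ?_ ?_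
      (ENNReal.ofReal_pos.2 hε).ne'
    · intro c s hs hμs ε hε
      obtain ⟨η, hη, hsmall⟩ := exists_eLpNorm_indicator_le (μ := μ) ENNReal.one_ne_top c hε
      obtain ⟨ψ, T, hψc, hψ, -, hT, hψT⟩ := exists_hasCompactSupport_eq_indicator_off_small hs hμs.ne
        (ENNReal.coe_pos.2 hη).ne'
      refine ⟨fun y => ψ y * c, (eLpNorm_mono fun y => ?_).trans (hsmall T hT.le),
        by fun_prop, hψc.mul_right⟩
      by_cases hyT : y ∈ T
      · have h1 := (hψ y).1
        have h2 := (hψ y).2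
        rw [Pi.sub_apply, Set.indicator_of_mem hyT]
        by_cases hys : y ∈ s
        · rw [Set.indicator_of_mem hys, ← sub_one_mul, norm_mul, Real.norm_eq_abs (ψ y - 1),
            abs_of_nonpos (by linarith)]
          exact mul_le_of_le_one_left (norm_nonneg _) (by linarith)
        · rw [Set.indicator_of_notMem hys, sub_zero, norm_mul, Real.norm_eq_abs (ψ y),
            abs_of_nonneg h1]
          exact mul_le_of_le_one_left (norm_nonneg _) h2
      · rw [Pi.sub_apply, hψT y hyT]
        by_cases hys : y ∈ s <;> simp [hys, hyT]
    · exact fun f g hf hg => ⟨hf.1.add hg.1, hf.2.add hg.2⟩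
    · exact fun f hf => hf.1.measurable.aestronglyMeasurable
  obtain ⟨k, hle, hk, hk'⟩ := this
  refine ⟨k, hk', ?_, hk⟩
  have hi : Integrable (h - k) μ := hh.sub (hk.integrable_of_hasCompactSupport hk')
  have := integral_norm_eq_lintegral_enorm hi.1
  rw [← eLpNorm_one_eq_lintegral_enorm] at this
  exact this.trans_le (ENNReal.toReal_le_of_le_ofReal hε.le hle)

end TestFunctions

/-! ### Integrable functions scaled by conjugations, and the [IN] property. -/

section Conjugation

open scoped Pointwise

theorem measurableEmbedding_conj {G : Type*} [Group G] [TopologicalSpace G] [IsTopologicalGroup G]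
    [MeasurableSpace G] [BorelSpace G] (t : G) : MeasurableEmbedding fun y : G => t * y * t⁻¹ :=
  ((Homeomorph.mulRight t⁻¹).measurableEmbedding).comp (Homeomorph.mulLeft t).measurableEmbedding

theorem integral_conj_eq_smul {G : Type*} [Group G] [TopologicalSpace G] [IsTopologicalGroup G]
    [MeasurableSpace G] [BorelSpace G] {μ : Measure G} {t : G} {c : NNReal}
    (hc : μ.map (fun y => t * y * t⁻¹) = c • μ) {E : Type*} [NormedAddCommGroup E]
    [NormedSpace ℝ E] (F : G → E) : ∫ y, F (t * y * t⁻¹) ∂μ = (c : ℝ) • ∫ y, F y ∂μ := by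
  rw [← (measurableEmbedding_conj t).integral_map, hc, integral_smul_nnreal_measure, NNReal.smul_def]

variable {G : Type*} [Group G] [TopologicalSpace G] [IsTopologicalGroup G] [LocallyCompactSpace G]
    [T2Space G] [MeasurableSpace G] [BorelSpace G]

omit [T2Space G] in
/-- Conjugation multiplies a regular Haar measure by a constant. -/
theorem exists_map_conj_eq_smul (μ : Measure G) [μ.IsHaarMeasure] [μ.Regular] (t : G) :
    ∃ c : NNReal, μ.map (fun y => t * y * t⁻¹) = c • μ := by
  let e : G ≃ₜ* G := { MulAut.conj t with
    continuous_toFun := by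
      change Continuous fun y => t * y * t⁻¹
      fun_prop
    continuous_invFun := by
      change Continuous fun y => t⁻¹ * y * t
      fun_prop }
  have : (μ.map e).Regular := Measure.Regular.map e.toHomeomorph
  exact ⟨_, Measure.isMulLeftInvariant_eq_smul_of_regular (μ.map e) μ⟩

omit [T2Space G] in
/-- If conjugation multiplies an integrable function by constants, then the `L¹`-distance of the
function to its left translates is a class function. -/
theorem integral_abs_sub_translate_conj (μ : Measure G) [μ.IsHaarMeasure] [μ.Regular]
    {h : G → ℝ} (hpos : 0 < ∫ y, |h y| ∂μ) {t : G} {c : ℝ}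
    (hc : ∀ᵐ y ∂μ, h (t * y * t⁻¹) = c * h y) (x : G) :
    ∫ y, |h y - h ((t * x * t⁻¹)⁻¹ * y)| ∂μ = ∫ y, |h y - h (x⁻¹ * y)| ∂μ := by
  obtain ⟨d, hd⟩ := exists_map_conj_eq_smul μ t
  -- Computing `∫ |h(tyt⁻¹)| dy` in two ways ties `c` to the Haar factor `d`, so the two scalings
  -- cancel in the `L¹`-distance.
  have hdc : (d : ℝ) = |c| := by
    have h1 := integral_conj_eq_smul hd fun y => |h y|
    have h2 : ∫ y, |h (t * y * t⁻¹)| ∂μ = |c| * ∫ y, |h y| ∂μ := by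
      rw [← integral_const_mul]
      refine integral_congr_ae (hc.mono fun y hy => ?_)
      simp only [hy, abs_mul]
    rw [h2, smul_eq_mul] at h1
    exact (mul_right_cancel₀ hpos.ne' h1).symm
  have hd0 : (d : ℝ) ≠ 0 := by
    have : d ≠ 0 := by
      rintro rfl
      rw [zero_smul, Measure.map_eq_zero_iff (measurableEmbedding_conj t).measurable.aemeasurable]
        at hd
      simp [hd] at hpos
    exact_mod_cast this
  have hx : ∀ᵐ y ∂μ, h (t * (x⁻¹ * y) * t⁻¹) = c * h (x⁻¹ * y) :=
    (measurePreserving_mul_left μ x⁻¹).quasiMeasurePreserving.ae hc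
  have key := integral_conj_eq_smul hd fun y => |h y - h ((t * x * t⁻¹)⁻¹ * y)|
  have h2 : ∫ y, |h (t * y * t⁻¹) - h ((t * x * t⁻¹)⁻¹ * (t * y * t⁻¹))| ∂μ
      = |c| * ∫ y, |h y - h (x⁻¹ * y)| ∂μ := by
    rw [← integral_const_mul]
    refine integral_congr_ae ?_
    filter_upwards [hc, hx] with y hy hxy
    have : (t * x * t⁻¹)⁻¹ * (t * y * t⁻¹) = t * (x⁻¹ * y) * t⁻¹ := by group
    rw [this, hy, hxy, ← mul_sub, abs_mul]
  rw [h2, smul_eq_mul, ← hdc] at key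
  exact (mul_left_cancel₀ hd0 key).symm

-- Passing to the closure gives compactness, and invariance survives because each conjugation is
-- continuous.
omit [LocallyCompactSpace G] [T2Space G] [MeasurableSpace G] [BorelSpace G] in
theorem isINGroup_of_conj_invariant_set {K L : Set G} (hK : K ∈ 𝓝 (1 : G)) (hL : IsCompact L)
    (hKL : K ⊆ L) (hinv : ∀ t : G, ∀ x ∈ K, t * x * t⁻¹ ∈ K) : IsINGroup G := by
  refine ⟨closure K, mem_of_superset hK subset_closure, hL.closure_of_subset hKL, fun g => ?_⟩
  have hsub : ∀ t : G, ∀ x ∈ closure K, t * x * t⁻¹ ∈ closure K := fun t x hx =>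
    map_mem_closure (f := fun x => t * x * t⁻¹) (by fun_prop) hx (hinv t)
  apply Set.Subset.antisymm
  · rintro _ ⟨x, hx, rfl⟩
    exact hsub g x hx
  · intro x hx
    exact ⟨g⁻¹ * x * g, by simpa using hsub g⁻¹ x hx, by group⟩

-- For `x` in a compact neighbourhood `t` of a given point, all the integrands vanish off one
-- compact set.
omit [T2Space G] in
theorem continuous_integral_abs_sub_translate (μ : Measure G) [IsFiniteMeasureOnCompacts μ]
    {k : G → ℝ} (hk : Continuous k) (hk' : HasCompactSupport k) :
    Continuous fun x => ∫ y, |k y - k (x⁻¹ * y)| ∂μ := by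
  rw [continuous_iff_continuousAt]
  intro x₀
  obtain ⟨t, ht, hx₀⟩ := exists_compact_mem_nhds x₀
  have hL : IsCompact (tsupport k ∪ t * tsupport k) := hk'.isCompact.union (ht.mul hk'.isCompact)
  refine ContinuousOn.continuousAt (s := t) ?_ hx₀
  refine continuousOn_integral_of_compact_support hL (by fun_prop) fun x y hx hy => ?_
  rw [Set.mem_union, not_or] at hy
  have h1 : k y = 0 := image_eq_zero_of_notMem_tsupport hy.1
  have h2 : k (x⁻¹ * y) = 0 := image_eq_zero_of_notMem_tsupport fun h =>
    hy.2 ⟨x, hx, x⁻¹ * y, h, by simp⟩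
  simp [h1, h2]

omit [LocallyCompactSpace G] [T2Space G] in
theorem abs_integral_abs_sub_translate_sub_le (μ : Measure G) [μ.IsHaarMeasure] {h k : G → ℝ}
    (hh : Integrable h μ) (hk : Integrable k μ) (x : G) :
    |∫ y, |h y - h (x⁻¹ * y)| ∂μ - ∫ y, |k y - k (x⁻¹ * y)| ∂μ| ≤ 2 * ∫ y, |h y - k y| ∂μ := by
  have hh' := hh.comp_mul_left x⁻¹
  have hk' := hk.comp_mul_left x⁻¹
  have h1 : ∫ y, |h y - h (x⁻¹ * y)| ∂μ - ∫ y, |k y - k (x⁻¹ * y)| ∂μ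
      = ∫ y, (|h y - h (x⁻¹ * y)| - |k y - k (x⁻¹ * y)|) ∂μ :=
    (integral_sub (hh.sub hh').abs (hk.sub hk').abs).symm
  have h2 : 2 * ∫ y, |h y - k y| ∂μ
      = ∫ y, (|h y - k y| + |h (x⁻¹ * y) - k (x⁻¹ * y)|) ∂μ := by
    refine Eq.trans ?_ (integral_add (hh.sub hk).abs (hh'.sub hk').abs).symm
    simp only [Pi.sub_apply]
    rw [integral_mul_left_eq_self (fun y => |h y - k y|) x⁻¹, two_mul]
  rw [h1, h2]
  refine (abs_integral_le_integral_abs).trans (integral_mono ?_ ?_ fun y => ?_)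
  · exact ((hh.sub hh').abs.sub (hk.sub hk').abs).abs
  · exact (hh.sub hk).abs.add (hh'.sub hk').abs
  · have h1 := abs_abs_sub_abs_le_abs_sub (h y - h (x⁻¹ * y)) (k y - k (x⁻¹ * y))
    have h2 := abs_sub (h y - k y) (h (x⁻¹ * y) - k (x⁻¹ * y))
    have h3 : h y - h (x⁻¹ * y) - (k y - k (x⁻¹ * y))
      = (h y - k y) - (h (x⁻¹ * y) - k (x⁻¹ * y)) := by ring
    rw [h3] at h1
    exact h1.trans h2

omit [LocallyCompactSpace G] [T2Space G] in
theorem integral_abs_sub_translate_of_disjoint (μ : Measure G) [μ.IsHaarMeasure] {k : G → ℝ}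
    (hk : Integrable k μ) {x : G} (hx : x ∉ Function.support k / Function.support k) :
    ∫ y, |k y - k (x⁻¹ * y)| ∂μ = 2 * ∫ y, |k y| ∂μ := by
  have h2 : 2 * ∫ y, |k y| ∂μ = ∫ y, (|k y| + |k (x⁻¹ * y)|) ∂μ := by
    rw [integral_add hk.abs (hk.comp_mul_left x⁻¹).abs,
      integral_mul_left_eq_self (fun y => |k y|) x⁻¹, two_mul]
  rw [h2]
  congr with y
  by_cases h1 : k y = 0
  · simp [h1]
  · have : k (x⁻¹ * y) = 0 := by
      by_contra h3
      exact hx ⟨y, h1, x⁻¹ * y, h3, by simp [div_eq_mul_inv]⟩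
    simp [this]

/-- A locally compact group that carries a nonzero integrable function which conjugations multiply
by constants is an [IN] group. -/
theorem isINGroup_of_integrable_conj (μ : Measure G) [μ.IsHaarMeasure] [μ.Regular] {h : G → ℝ}
    (hh : Integrable h μ) (hne : ¬ h =ᵐ[μ] 0)
    (hconj : ∀ t : G, ∃ c : ℝ, ∀ᵐ y ∂μ, h (t * y * t⁻¹) = c * h y) : IsINGroup G := by
  set m := ∫ y, |h y| ∂μ with hm
  have hpos : 0 < m := by
    refine lt_of_le_of_ne (integral_nonneg fun y => abs_nonneg _) fun h0 => hne ?_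
    rw [eq_comm, integral_eq_zero_iff_of_nonneg (fun y => abs_nonneg _) hh.abs] at h0
    exact h0.mono fun y hy => abs_eq_zero.1 hy
  -- With error `m / 8` the distance for `h` is at most `2m/8 + m/8 < m` near `1`, and at least `2(m
  -- - m/8) - 2m/8 = 3m/2 > m` where the translate of `k` is disjoint from `k`.
  obtain ⟨k, hk', hhk, hk⟩ :=
    exists_hasCompactSupport_integral_abs_sub_le hh (show 0 < m / 8 by positivity)
  have hki : Integrable k μ := hk.integrable_of_hasCompactSupport hk'
  have hclose := abs_integral_abs_sub_translate_sub_le μ hh hki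
  have hkm : m - m / 8 ≤ ∫ y, |k y| ∂μ := by
    have : m ≤ ∫ y, (|h y - k y| + |k y|) ∂μ :=
      integral_mono hh.abs ((hh.sub hki).abs.add hki.abs) fun y => by
        simpa using abs_add_le (h y - k y) (k y)
    have h1 : m ≤ ∫ y, |h y - k y| ∂μ + ∫ y, |k y| ∂μ :=
      this.trans_eq (integral_add (hh.sub hki).abs hki.abs)
    linarith
  refine isINGroup_of_conj_invariant_set (K := {x | ∫ y, |h y - h (x⁻¹ * y)| ∂μ ≤ m})
    (L := tsupport k / tsupport k) ?_ (by
      rw [div_eq_mul_inv]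
      exact IsCompact.mul hk' (IsCompact.inv hk')) ?_ ?_
  · have h1 := (continuous_integral_abs_sub_translate μ hk hk').tendsto 1
    simp only [inv_one, one_mul, sub_self, abs_zero, integral_zero] at h1
    filter_upwards [h1.eventually_lt_const (show 0 < m / 8 by positivity)] with x hx
    have := (abs_le.1 (hclose x)).2
    change ∫ y, |h y - h (x⁻¹ * y)| ∂μ ≤ m
    linarith
  · intro x hx
    by_contra hxk
    have h1 := integral_abs_sub_translate_of_disjoint μ hki (x := x) fun h =>
      hxk (Set.div_subset_div (subset_tsupport k) (subset_tsupport k) h)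
    have := (abs_le.1 (hclose x)).1
    change ∫ y, |h y - h (x⁻¹ * y)| ∂μ ≤ m at hx
    linarith
  · intro t x hx
    obtain ⟨c, hc⟩ := hconj t
    exact (integral_abs_sub_translate_conj μ hpos hc x).trans_le hx

end Conjugation

/-! ### Comparison of left Haar measure with its image under inversion. -/

section Inversion

variable {G : Type*} [Group G] [TopologicalSpace G] [IsTopologicalGroup G] [LocallyCompactSpace G]
    [T2Space G] [MeasurableSpace G] [BorelSpace G]

omit [T2Space G] in
/-- The right Haar measure `μ.inv` has a continuous positive density with respect to `μ`, in the
sense of integrals of continuous compactly supported functions. -/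
theorem exists_integral_inv_eq_integral_mul (μ : Measure G) [μ.IsHaarMeasure] :
    ∃ D : G → ℝ, Continuous D ∧ ∀ ψ : G → ℝ, Continuous ψ → HasCompactSupport ψ →
      ∫ y, ψ y ∂μ.inv = ∫ y, ψ y * D y ∂μ := by
  obtain ⟨⟨g, hg⟩, hg', hg0, hg1⟩ := exists_continuous_nonneg_pos (1 : G)
  change HasCompactSupport g at hg'
  change 0 ≤ g at hg0
  change g 1 ≠ 0 at hg1
  have hgpos : 0 < ∫ x, g x ∂μ := hg.integral_pos_of_hasCompactSupport_nonneg_nonzero hg' hg0 hg1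
  set D : G → ℝ := fun y => ∫ z, g (z⁻¹ * y) ∂μ.inv with hD
  have hDc : Continuous D := continuous_integral_apply_inv_mul hg hg'
  have hDpos : ∀ y, D y ≠ 0 := fun y => by
    have C : Continuous fun z => g (z⁻¹ * y) := by fun_prop
    refine (C.integral_pos_of_hasCompactSupport_nonneg_nonzero (x := y)
      (hg'.comp_homeomorph ((Homeomorph.inv G).trans (Homeomorph.mulRight y)))
      (fun z => hg0 (z⁻¹ * y)) (by simpa using hg1)).ne'
  refine ⟨fun y => D y * (∫ x, g x ∂μ)⁻¹, by fun_prop, fun ψ hψ hψ' => ?_⟩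
  -- The uniqueness identity for Haar measures divides its test function by `D`; testing with `ψ *
  -- D` leaves `∫ ψ dμ.inv · ∫ g dμ`.
  have := Measure.integral_isMulLeftInvariant_isMulRightInvariant_combo (μ := μ) (ν := μ.inv)
    (hψ.mul hDc) hψ'.mul_right hg hg' hg0 hg1
  simp_rw [← mul_assoc]
  rw [integral_mul_const]
  refine Eq.trans ?_ (congrArg (· * (∫ x, g x ∂μ)⁻¹) this.symm)
  rw [mul_inv_cancel_right₀ hgpos.ne']
  congr with y
  exact (mul_inv_cancel_right₀ (hDpos y) _).symm

/-- Inner regularity and a Urysohn function between a compact `K ⊆ U` and `U` turn the identity of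
integrals into an inequality of measures. -/
theorem inv_le_smul_of_isOpen {μ : Measure G} [μ.IsHaarMeasure] [μ.Regular] {D : G → ℝ}
    (hDc : Continuous D) (hD : ∀ ψ : G → ℝ, Continuous ψ → HasCompactSupport ψ →
      ∫ y, ψ y ∂μ.inv = ∫ y, ψ y * D y ∂μ) {U : Set G} (hU : IsOpen U) {M : NNReal}
    (hUD : ∀ y ∈ U, D y ≤ M) : μ.inv U ≤ M * μ U := by
  rw [hU.measure_eq_iSup_isCompact]
  refine iSup₂_le fun K hKU => iSup_le fun hK => ?_
  obtain ⟨ψ, hψK, hψc, hψU, hψ⟩ := exists_continuousMap_one_of_isCompact_subset_isOpen hK hU hKU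
  have hψ' : HasCompactSupport ψ := hψc
  have h1 : μ.inv K ≤ ENNReal.ofReal (∫ y, ψ y ∂μ.inv) := by
    rw [ofReal_integral_eq_lintegral_ofReal
      (ψ.continuous.integrable_of_hasCompactSupport hψ') (.of_forall fun y => (hψ y).1),
      ← lintegral_indicator_one hK.measurableSet]
    refine lintegral_mono fun y => ?_
    by_cases hy : y ∈ K
    · have : ψ y = 1 := hψK hy
      simp [hy, this]
    · simp [hy]
  have h2 : ∫ y, ψ y ∂μ.inv ≤ M * ∫ y, ψ y ∂μ := by
    rw [hD ψ ψ.continuous hψ', ← integral_const_mul]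
    refine integral_mono ((ψ.continuous.mul hDc).integrable_of_hasCompactSupport hψ'.mul_right)
      ((ψ.continuous.integrable_of_hasCompactSupport hψ').const_mul _) fun y => ?_
    by_cases hy : y ∈ U
    · simpa only [mul_comm] using mul_le_mul_of_nonneg_right (hUD y hy) (hψ y).1
    · have : ψ y = 0 := image_eq_zero_of_notMem_tsupport fun h => hy (hψU h)
      simp [this]
  have h3 : ENNReal.ofReal (∫ y, ψ y ∂μ) ≤ μ U := by
    rw [ofReal_integral_eq_lintegral_ofReal
      (ψ.continuous.integrable_of_hasCompactSupport hψ') (.of_forall fun y => (hψ y).1),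
      ← lintegral_indicator_one hU.measurableSet]
    refine lintegral_mono fun y => ?_
    by_cases hy : y ∈ U
    · simpa [hy] using (hψ y).2
    · have : ψ y = 0 := image_eq_zero_of_notMem_tsupport fun h => hy (hψU h)
      simp [this]
  calc μ.inv K ≤ ENNReal.ofReal (M * ∫ y, ψ y ∂μ) := h1.trans (ENNReal.ofReal_le_ofReal h2)
    _ = M * ENNReal.ofReal (∫ y, ψ y ∂μ) := by
        rw [ENNReal.ofReal_mul M.coe_nonneg, ENNReal.ofReal_coe_nnreal]
    _ ≤ M * μ U := by gcongr

/-- Outer regularity reduces to open sets; the strict bound on `s` allows every open `U ⊇ s` to be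
shrunk to `U ∩ {D < M}`. -/
theorem inv_le_smul {μ : Measure G} [μ.IsHaarMeasure] [μ.Regular] {D : G → ℝ}
    (hDc : Continuous D) (hD : ∀ ψ : G → ℝ, Continuous ψ → HasCompactSupport ψ →
      ∫ y, ψ y ∂μ.inv = ∫ y, ψ y * D y ∂μ) {s : Set G} {M : NNReal}
    (hM : M ≠ 0) (hsD : ∀ y ∈ s, D y < M) : μ.inv s ≤ M * μ s := by
  rw [s.measure_eq_iInf_isOpen μ, ENNReal.mul_iInf' (by simp) (by simp [hM])]
  refine le_iInf fun U => ?_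
  rw [ENNReal.mul_iInf' (by simp) (by simp [hM])]
  refine le_iInf fun hsU => ?_
  rw [ENNReal.mul_iInf' (by simp) (by simp [hM])]
  refine le_iInf fun hU => ?_
  have hDU : IsOpen {y | D y < M} := isOpen_lt hDc continuous_const
  calc μ.inv s ≤ μ.inv (U ∩ {y | D y < M}) := measure_mono fun y hy => ⟨hsU hy, hsD y hy⟩
    _ ≤ M * μ (U ∩ {y | D y < M}) :=
        inv_le_smul_of_isOpen hDc hD (hU.inter hDU) fun y hy => hy.2.le
    _ ≤ M * μ U := by
        gcongr
        exact Set.inter_subset_left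

theorem inv_absolutelyContinuous (μ : Measure G) [μ.IsHaarMeasure] [μ.Regular] : μ.inv ≪ μ := by
  obtain ⟨D, hDc, hD⟩ := exists_integral_inv_eq_integral_mul μ
  intro s hs
  -- `D` need not be bounded on `s`, so `s` is cut into countably many pieces where it is.
  have : s = ⋃ n : ℕ, s ∩ {y | D y < (n + 1 : ℕ)} := by
    ext y
    simp only [Set.mem_iUnion, Set.mem_inter_iff, Set.mem_ofPred_eq, exists_and_left, iff_self_and]
    exact fun _ => (exists_nat_gt (D y)).imp fun n hn => hn.trans (by simp)
  rw [this]
  refine measure_iUnion_null fun n => le_antisymm ?_ zero_le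
  refine (inv_le_smul hDc hD (M := (n + 1 : ℕ)) (by simp) fun y hy => by simpa using hy.2).trans ?_
  rw [measure_mono_null Set.inter_subset_left hs, mul_zero]

theorem absolutelyContinuous_inv (μ : Measure G) [μ.IsHaarMeasure] [μ.Regular] : μ ≪ μ.inv := by
  intro s hs
  rw [Measure.inv_apply] at hs
  simpa using inv_absolutelyContinuous μ hs

theorem integrableOn_inv (μ : Measure G) [μ.IsHaarMeasure] [μ.Regular] {E : Type*}
    [NormedAddCommGroup E] {F : G → E} {K : Set G} (hK : IsCompact K)
    (hF : IntegrableOn F K μ) : IntegrableOn F K μ.inv := by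
  obtain ⟨D, hDc, hD⟩ := exists_integral_inv_eq_integral_mul μ
  obtain ⟨M, hM⟩ := (hK.image hDc).bddAbove
  have hle : μ.inv.restrict K ≤ ((|M| + 1).toNNReal : ENNReal) • μ.restrict K := by
    refine Measure.le_iff.2 fun s hs => ?_
    rw [Measure.restrict_apply hs, Measure.smul_apply, Measure.restrict_apply hs, smul_eq_mul]
    refine inv_le_smul hDc hD (by positivity) fun y hy => ?_
    have := hM ⟨y, hy.2, rfl⟩
    refine lt_of_lt_of_le ?_ (Real.le_coe_toNNReal _)
    linarith [le_abs_self M]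
  exact Integrable.mono_measure (hF.smul_measure ENNReal.coe_ne_top) hle

theorem quasiMeasurePreserving_inv_haar (μ : Measure G) [μ.IsHaarMeasure] [μ.Regular] :
    Measure.QuasiMeasurePreserving (Inv.inv : G → G) μ μ :=
  ⟨measurable_inv, inv_absolutelyContinuous μ⟩

end Inversion

/-! ### Vanishing on compact sets and vanishing almost everywhere. -/

section Local

variable {G : Type*} [TopologicalSpace G] [LocallyCompactSpace G] [T2Space G] [MeasurableSpace G]
    [BorelSpace G] {μ : Measure G} [μ.Regular] {E : Type*} [NormedAddCommGroup E] [NormedSpace ℝ E]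
    [CompleteSpace E]

/-- When `G` is not σ-compact, vanishing a.e. on each compact set does not by itself give vanishing
a.e.; integrability of `F` makes it enough, since test functions see only compact sets. -/
theorem ae_eq_zero_of_forall_isCompact {F : G → E} (hF : Integrable F μ)
    (h : ∀ K : Set G, IsCompact K → F =ᵐ[μ.restrict K] 0) : F =ᵐ[μ] 0 := by
  refine ae_eq_zero_of_integral_hasCompactSupport_smul hF fun ψ _ hψ => ?_
  rw [← setIntegral_eq_integral_of_forall_compl_eq_zero (s := tsupport ψ) fun y hy => by
    rw [image_eq_zero_of_notMem_tsupport hy, zero_smul]]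
  refine (integral_congr_ae ((h _ hψ).mono fun y hy => ?_)).trans (integral_zero _ _)
  simp [hy]

omit [LocallyCompactSpace G] [T2Space G] [μ.Regular] [CompleteSpace E] in
theorem integrable_hasCompactSupport_smul {F : G → E}
    (hF : ∀ K : Set G, IsCompact K → IntegrableOn F K μ) {ψ : G → ℝ} (hψ : Continuous ψ)
    (hψ' : HasCompactSupport ψ) : Integrable (fun y => ψ y • F y) μ := by
  obtain ⟨C, hC⟩ := hψ.bounded_above_of_compact_support hψ'
  rw [← integrableOn_iff_integrable_of_support_subset (s := tsupport ψ)]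
  · exact (hF _ hψ').bdd_smul C hψ.measurable.aestronglyMeasurable (.of_forall hC)
  · intro y hy
    by_contra h0
    exact hy (by simp [image_eq_zero_of_notMem_tsupport h0])

theorem ae_restrict_eq_zero_of_integral_hasCompactSupport_smul {F : G → E}
    (hF : ∀ K : Set G, IsCompact K → IntegrableOn F K μ)
    (h : ∀ ψ : G → ℝ, Continuous ψ → HasCompactSupport ψ → ∫ y, ψ y • F y ∂μ = 0)
    {K : Set G} (hK : IsCompact K) : F =ᵐ[μ.restrict K] 0 := by
  -- A cutoff `χ` equal to `1` on `K` makes `F` integrable, and `ψ * χ` is again a test function.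
  obtain ⟨χ, hχK, hχ, -, hχ1⟩ :=
    exists_continuousMap_one_of_isCompact_subset_isOpen hK isOpen_univ (Set.subset_univ K)
  have hi := integrable_hasCompactSupport_smul hF χ.continuous hχ
  have h0 : (fun y => χ y • F y) =ᵐ[μ] 0 :=
    ae_eq_zero_of_integral_hasCompactSupport_smul hi fun ψ hψ hψ' => by
      simpa only [mul_smul] using h (fun y => ψ y * χ y) (hψ.mul χ.continuous) hψ'.mul_right
  filter_upwards [ae_restrict_of_ae h0, ae_restrict_mem hK.measurableSet] with y hy hyK
  simpa [hχK hyK] using hy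

end Local

/-! ### Local bounds for weights. -/

section Weight

open scoped Pointwise

variable {G : Type*} [Group G] [MeasurableSpace G] {w : G → ℝ}

theorem IsWeight.one_le_one (hw : IsWeight w) : 1 ≤ w 1 := by
  have h := hw.mul_le 1 1
  rw [mul_one] at h
  exact (le_mul_iff_one_le_left (hw.pos 1)).1 h

theorem IsWeight.le_mul_conj (hw : IsWeight w) (t y : G) :
    w y ≤ w t⁻¹ * w t * w (t * y * t⁻¹) := by
  calc w y = w (t⁻¹ * (t * y * t⁻¹) * t) := by group
    _ ≤ w (t⁻¹ * (t * y * t⁻¹)) * w t := hw.mul_le _ _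
    _ ≤ w t⁻¹ * w (t * y * t⁻¹) * w t :=
        mul_le_mul_of_nonneg_right (hw.mul_le _ _) (hw.pos t).le
    _ = w t⁻¹ * w t * w (t * y * t⁻¹) := by ring

variable [TopologicalSpace G] [IsTopologicalGroup G] [LocallyCompactSpace G] [T2Space G]
    [BorelSpace G]

/-- A measurable weight is bounded near the identity. -/
theorem IsWeight.exists_nhds_one_le (hw : IsWeight w) (μ : Measure G) [μ.IsHaarMeasure]
    [μ.Regular] : ∃ V ∈ 𝓝 (1 : G), ∃ M : ℝ, ∀ x ∈ V, w x ≤ M := by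
  obtain ⟨K, hK, hK1⟩ := exists_compact_mem_nhds (1 : G)
  have hKpos : 0 < μ K := Measure.measure_pos_of_mem_nhds μ hK1
  -- A Steinhaus argument: some `s n` has positive measure, so `s n / s n` is a neighbourhood of
  -- `1`. Bounding `w x⁻¹` too gives `w ≤ n * n` on it.
  let s : ℕ → Set G := fun n => K ∩ ({x | w x ≤ n} ∩ {x | w x⁻¹ ≤ n})
  have hs : ∀ n, MeasurableSet (s n) := fun n =>
    hK.measurableSet.inter ((measurableSet_le hw.measurable measurable_const).inter
      (measurableSet_le (hw.measurable.comp measurable_inv) measurable_const))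
  have hKs : K ⊆ ⋃ n, s n := fun x hx => by
    obtain ⟨n, hn⟩ := exists_nat_ge (max (w x) (w x⁻¹))
    exact Set.mem_iUnion.2 ⟨n, hx, (le_max_left _ _).trans hn, (le_max_right _ _).trans hn⟩
  obtain ⟨n, hn⟩ : ∃ n, 0 < μ (s n) := by
    by_contra! h
    exact hKpos.ne' (measure_mono_null hKs (measure_iUnion_null fun n => le_antisymm (h n) zero_le))
  refine ⟨s n / s n, Measure.div_mem_nhds_one_of_haar_pos_ne_top μ (s n) (hs n) hn
    (measure_ne_top_of_subset Set.inter_subset_left hK.measure_ne_top), n * n, ?_⟩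
  rintro _ ⟨x, hx, y, hy, rfl⟩
  calc w (x / y) ≤ w x * w y⁻¹ := by
        rw [div_eq_mul_inv]
        exact hw.mul_le _ _
    _ ≤ n * n := mul_le_mul hx.2.1 hy.2.2 (hw.pos _).le (Nat.cast_nonneg n)

theorem IsWeight.exists_le_on_isCompact (hw : IsWeight w) (μ : Measure G) [μ.IsHaarMeasure]
    [μ.Regular] {K : Set G} (hK : IsCompact K) : ∃ M : ℝ, ∀ x ∈ K, w x ≤ M := by
  obtain ⟨V, hV, M, hM⟩ := hw.exists_nhds_one_le μ
  refine hK.induction_on (p := fun s => ∃ M : ℝ, ∀ x ∈ s, w x ≤ M) ⟨0, by simp⟩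
    (fun s t hst ⟨M, hM⟩ => ⟨M, fun x hx => hM x (hst hx)⟩) ?_ fun x _ => ?_
  · rintro s t ⟨M, hM⟩ ⟨N, hN⟩
    refine ⟨max M N, ?_⟩
    rintro x (hx | hx)
    · exact (hM x hx).trans (le_max_left _ _)
    · exact (hN x hx).trans (le_max_right _ _)
  · have hc : Tendsto (fun y => x⁻¹ * y) (𝓝 x) (𝓝 1) := by
      have : Continuous fun y => x⁻¹ * y := by fun_prop
      simpa using this.tendsto x
    refine ⟨_, mem_nhdsWithin_of_mem_nhds (hc hV), w x * M, fun y hy => ?_⟩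
    calc w y = w (x * (x⁻¹ * y)) := by group
      _ ≤ w x * w (x⁻¹ * y) := hw.mul_le _ _
      _ ≤ w x * M := mul_le_mul_of_nonneg_left (hM _ hy) (hw.pos x).le

/-- This lower bound, from `1 ≤ w 1 ≤ w x⁻¹ * w x`, makes elements of `L¹_w` locally integrable for
Haar measure. -/
theorem IsWeight.exists_one_le_mul_on_isCompact (hw : IsWeight w) (μ : Measure G)
    [μ.IsHaarMeasure] [μ.Regular] {K : Set G} (hK : IsCompact K) :
    ∃ M : ℝ, ∀ x ∈ K, 1 ≤ M * w x := by
  obtain ⟨M, hM⟩ := hw.exists_le_on_isCompact μ hK.inv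
  refine ⟨M, fun x hx => ?_⟩
  calc 1 ≤ w 1 := hw.one_le_one
    _ = w (x⁻¹ * x) := by simp
    _ ≤ w x⁻¹ * w x := hw.mul_le _ _
    _ ≤ M * w x := mul_le_mul_of_nonneg_right (hM _ (by simpa using hx)) (hw.pos x).le

end Weight

/-! ### Integrability with respect to the weighted measure. -/

section WeightedMeasure

variable {G : Type*} [Group G] [MeasurableSpace G] {w : G → ℝ} {μ : Measure G}
    {E : Type*} [NormedAddCommGroup E] [NormedSpace ℝ E]

theorem IsWeight.absolutelyContinuous_weightedMeasure (hw : IsWeight w) :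
    μ ≪ weightedMeasure μ w :=
  withDensity_absolutelyContinuous' hw.measurable.ennreal_ofReal.aemeasurable
    (.of_forall fun x => by simpa using hw.pos x)

omit [Group G] in
theorem weightedMeasure_absolutelyContinuous (μ : Measure G) (w : G → ℝ) :
    weightedMeasure μ w ≪ μ :=
  withDensity_absolutelyContinuous _ _

theorem IsWeight.integrable_weightedMeasure_iff (hw : IsWeight w) {F : G → E} :
    Integrable F (weightedMeasure μ w) ↔ Integrable (fun x => w x • F x) μ := by
  rw [weightedMeasure, show (fun x => ENNReal.ofReal (w x)) = fun x => ((w x).toNNReal : ENNReal)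
    from rfl, integrable_withDensity_iff_integrable_smul hw.measurable.real_toNNReal]
  refine integrable_congr (.of_forall fun x => ?_)
  simp only [NNReal.smul_def, Real.coe_toNNReal _ (hw.pos x).le]

variable [TopologicalSpace G] [IsTopologicalGroup G] [LocallyCompactSpace G] [T2Space G]
    [BorelSpace G] [μ.IsHaarMeasure] [μ.Regular]

theorem IsWeight.integrableOn_isCompact (hw : IsWeight w) {F : G → E} (hF : StronglyMeasurable F)
    (hi : Integrable F (weightedMeasure μ w)) {K : Set G} (hK : IsCompact K) :
    IntegrableOn F K μ := by
  obtain ⟨M, hM⟩ := hw.exists_one_le_mul_on_isCompact μ hK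
  refine ((hw.integrable_weightedMeasure_iff.1 hi).integrableOn.smul M).mono
    hF.aestronglyMeasurable ?_
  filter_upwards [ae_restrict_mem hK.measurableSet] with y hy
  simp only [Pi.smul_apply, smul_smul, norm_smul]
  exact le_mul_of_one_le_left (norm_nonneg _) ((hM y hy).trans (le_abs_self _))

theorem IsWeight.integrable_smul_const (hw : IsWeight w) {φ : G → ℝ} (hφ : Continuous φ)
    (hφ' : HasCompactSupport φ) (a : E) :
    Integrable (fun y => φ y • a) (weightedMeasure μ w) := by
  rw [hw.integrable_weightedMeasure_iff]
  simp_rw [smul_smul]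
  refine Integrable.smul_const ?_ a
  obtain ⟨M, hM⟩ := hw.exists_le_on_isCompact μ hφ'
  refine ((hφ.integrable_of_hasCompactSupport (μ := μ) hφ').const_mul M).mono
    (hw.measurable.mul hφ.measurable).aestronglyMeasurable (.of_forall fun y => ?_)
  by_cases hy : y ∈ tsupport φ
  · rw [norm_mul, norm_mul, Real.norm_of_nonneg (hw.pos y).le]
    exact mul_le_mul_of_nonneg_right ((hM y hy).trans (le_abs_self _)) (norm_nonneg _)
  · simp [image_eq_zero_of_notMem_tsupport hy]

omit [IsTopologicalGroup G] [μ.IsHaarMeasure] in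
theorem IsWeight.ae_eq_zero_of_forall_isCompact [CompleteSpace E] (hw : IsWeight w) {F : G → E}
    (hi : Integrable F (weightedMeasure μ w))
    (h : ∀ K : Set G, IsCompact K → F =ᵐ[μ.restrict K] 0) : F =ᵐ[μ] 0 := by
  have := _root_.ae_eq_zero_of_forall_isCompact (hw.integrable_weightedMeasure_iff.1 hi)
    fun K hK => (h K hK).mono fun y hy => by simp [hy]
  exact this.mono fun y hy => (smul_eq_zero.1 hy).resolve_left (hw.pos y).ne'

-- Conjugation preserves `L¹_w` for any weight: it scales Haar measure, and `w y ≤ w t⁻¹ * w t * w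
-- (t * y * t⁻¹)`.
omit [T2Space G] in
theorem IsWeight.integrable_conj (hw : IsWeight w) {F : G → E} (hF : StronglyMeasurable F)
    (hi : Integrable F (weightedMeasure μ w)) (t : G) :
    Integrable (fun y => F (t * y * t⁻¹)) (weightedMeasure μ w) := by
  rw [hw.integrable_weightedMeasure_iff] at hi ⊢
  obtain ⟨d, hd⟩ := exists_map_conj_eq_smul μ t
  have h1 : Integrable (fun y => w (t * y * t⁻¹) • F (t * y * t⁻¹)) μ := by
    have := (measurableEmbedding_conj t).integrable_map_iff (μ := μ) (g := fun x => w x • F x)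
    refine this.1 ?_
    rw [hd]
    exact hi.smul_measure_nnreal
  refine (h1.smul (w t⁻¹ * w t)).mono (hw.measurable.stronglyMeasurable.smul
    (hF.comp_measurable (measurableEmbedding_conj t).measurable)).aestronglyMeasurable
    (.of_forall fun y => ?_)
  simp only [Pi.smul_apply, smul_smul, norm_smul]
  refine mul_le_mul_of_nonneg_right ?_ (norm_nonneg _)
  rw [Real.norm_of_nonneg (hw.pos y).le]
  exact (hw.le_mul_conj t y).trans (le_abs_self _)

end WeightedMeasure

/-! ### Multiplication by constants in a non-unital algebra. -/

section MulConst

variable {X A : Type*} [MeasurableSpace X] {μ : Measure X} [NonUnitalNormedRing A]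
    [NormedSpace ℂ A] [IsScalarTower ℂ A A] [SMulCommClass ℂ A A] {F : X → A}

theorem integrable_nonUnital_mul_const (hF : Integrable F μ) (a : A) :
    Integrable (fun y => F y * a) μ :=
  ((ContinuousLinearMap.mul ℂ A).flip a).integrable_comp hF

theorem integrable_nonUnital_const_mul (hF : Integrable F μ) (a : A) :
    Integrable (fun y => a * F y) μ :=
  (ContinuousLinearMap.mul ℂ A a).integrable_comp hF

end MulConst

/-! ### Consequences of centrality. -/

section Convolution

variable {G : Type*} [Group G] [TopologicalSpace G] [IsTopologicalGroup G] [LocallyCompactSpace G]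
    [T2Space G] [MeasurableSpace G] [BorelSpace G]

omit [Group G] [IsTopologicalGroup G] [T2Space G] in
theorem continuous_integral_smul_of_hasCompactSupport {E : Type*} [NormedAddCommGroup E]
    [NormedSpace ℝ E] {μ : Measure G} {F : G → E}
    (hF : ∀ K : Set G, IsCompact K → IntegrableOn F K μ) {Φ : G → G → ℝ}
    (hΦ : Continuous Φ.uncurry)
    (hΦ' : ∀ t : Set G, IsCompact t → ∃ K : Set G, IsCompact K ∧ ∀ x ∈ t, ∀ y ∉ K, Φ x y = 0) :
    Continuous fun x => ∫ y, Φ x y • F y ∂μ := by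
  rw [continuous_iff_continuousAt]
  intro x₀
  obtain ⟨t, ht, hx₀⟩ := exists_compact_mem_nhds x₀
  obtain ⟨K, hK, hKt⟩ := hΦ' t ht
  exact (continuousOn_integral_bilinear_of_locally_integrable_of_compact_support
    (ContinuousLinearMap.lsmul ℝ ℝ (E := E)).flip hK hΦ.continuousOn
    (fun x y hx hy => hKt x hx y hy) (hF K hK)).continuousAt hx₀

variable {A : Type*} [NonUnitalNormedRing A] [NormedSpace ℂ A] [IsScalarTower ℂ A A]
    [SMulCommClass ℂ A A] {μ : Measure G} [μ.IsHaarMeasure] [μ.Regular] {w : G → ℝ}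

-- The change of variables moves `x` from `f` into the continuous factor `φ`, so that the
-- convolution is visibly continuous in `x`.
omit [IsScalarTower ℂ A A] in
theorem beurlingConv_smul_const {f g : G → A} {φ : G → ℝ} {a : A}
    (hg : g =ᵐ[μ] fun y => φ y • a) (x : G) :
    beurlingConv μ f g x = ∫ y, φ (y⁻¹ * x) • (f y * a) ∂μ := by
  rw [← integral_mul_left_eq_self _ x]
  refine integral_congr_ae (((quasiMeasurePreserving_inv_haar μ).ae hg).mono fun y hy => ?_)
  simp only [hy, mul_smul_comm, mul_inv_rev, inv_mul_cancel_right]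

-- Here `x` already sits in `φ`; inverting the variable to free `f` is what brings in `μ.inv`.
omit [LocallyCompactSpace G] [T2Space G] [SMulCommClass ℂ A A] [μ.Regular] in
theorem beurlingConv_const_smul {f g : G → A} {φ : G → ℝ} {a : A}
    (hg : g =ᵐ[μ] fun y => φ y • a) (x : G) :
    beurlingConv μ g f x = ∫ y, φ (x * y⁻¹) • (a * f y) ∂μ.inv := by
  refine Eq.trans ?_ ((Homeomorph.inv G).measurableEmbedding.integral_map _).symm
  refine integral_congr_ae
    (((measurePreserving_mul_left μ x).quasiMeasurePreserving.ae hg).mono fun y hy => ?_)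
  simp only [hy, smul_mul_assoc, Homeomorph.coe_inv, inv_inv]

/-- An element of the center of `L¹_w(G, A)` commutes with `φ ⊗ a` pointwise, for every continuous
compactly supported `φ` and every `a`. -/
theorem integral_eq_of_mem_beurlingCenter (hw : IsWeight w) {f : BeurlingSpace μ w A}
    (hf : f ∈ beurlingCenter μ w A) {φ : G → ℝ} (hφ : Continuous φ) (hφ' : HasCompactSupport φ)
    (a : A) (x : G) :
    ∫ y, φ (y⁻¹ * x) • (f y * a) ∂μ = ∫ y, φ (x * y⁻¹) • (a * f y) ∂μ.inv := by
  have hi := L1.integrable_coeFn f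
  have hloc : ∀ K : Set G, IsCompact K → IntegrableOn f K μ := fun K hK =>
    hw.integrableOn_isCompact (Lp.stronglyMeasurable f) hi hK
  have hg := hw.integrable_smul_const (μ := μ) hφ hφ' a
  have hgae : hg.toL1 =ᵐ[μ] fun y => φ y • a :=
    hw.absolutelyContinuous_weightedMeasure.ae_eq hg.coeFn_toL1
  have h := hw.absolutelyContinuous_weightedMeasure.ae_eq (hf hg.toL1)
  have h1 := funext (beurlingConv_smul_const (f := f) hgae)
  have h2 := funext (beurlingConv_const_smul (f := f) hgae)
  -- Both sides are continuous in `x` and Haar measure charges open sets, so a.e. equality holds at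
  -- every point.
  rw [h1, h2, Continuous.ae_eq_iff_eq] at h
  · exact congrFun h x
  · refine continuous_integral_smul_of_hasCompactSupport
      (fun K hK => integrable_nonUnital_mul_const (hloc K hK) a)
      (Φ := fun x y => φ (y⁻¹ * x)) (by fun_prop)
      fun t ht => ⟨(fun p : G × G => p.1 * p.2⁻¹) '' (t ×ˢ tsupport φ),
        (ht.prod hφ').image (by fun_prop), fun x hx y hy => ?_⟩
    refine image_eq_zero_of_notMem_tsupport fun h => hy ⟨(x, y⁻¹ * x), ⟨hx, h⟩, by simp⟩
  · refine continuous_integral_smul_of_hasCompactSupport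
      (fun K hK => integrableOn_inv μ hK (integrable_nonUnital_const_mul (hloc K hK) a))
      (Φ := fun x y => φ (x * y⁻¹)) (by fun_prop)
      fun t ht => ⟨(fun p : G × G => p.2⁻¹ * p.1) '' (t ×ˢ tsupport φ),
        (ht.prod hφ').image (by fun_prop), fun x hx y hy => ?_⟩
    refine image_eq_zero_of_notMem_tsupport fun h => hy ⟨(x, x * y⁻¹), ⟨hx, h⟩, by simp⟩

theorem integral_conj_of_mem_beurlingCenter (hw : IsWeight w) {f : BeurlingSpace μ w A}
    (hf : f ∈ beurlingCenter μ w A) {ψ : G → ℝ} (hψ : Continuous ψ) (hψ' : HasCompactSupport ψ)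
    (a : A) (t : G) :
    ∫ y, ψ y • (f y * a) ∂μ = ∫ y, ψ (t * y * t⁻¹) • (a * f y) ∂μ.inv := by
  -- At `x = t` this `φ` satisfies `φ (y⁻¹ * t) = ψ y` and `φ (t * y⁻¹) = ψ (t * y * t⁻¹)`.
  have h := integral_eq_of_mem_beurlingCenter hw hf (φ := fun z => ψ (t * z⁻¹)) (by fun_prop)
    (hψ'.comp_homeomorph ((Homeomorph.inv G).trans (Homeomorph.mulLeft t))) a t
  simpa [mul_assoc] using h

/-- The previous identity for `ψ` at `t` and for `ψ (t * · * t⁻¹)` at `1` has the same right-hand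
side, which eliminates both `a * f y` and `μ.inv`. -/
theorem integral_conj_invariant_of_mem_beurlingCenter (hw : IsWeight w) {f : BeurlingSpace μ w A}
    (hf : f ∈ beurlingCenter μ w A) {ψ : G → ℝ} (hψ : Continuous ψ) (hψ' : HasCompactSupport ψ)
    (a : A) (t : G) :
    ∫ y, ψ (t * y * t⁻¹) • (f y * a) ∂μ = ∫ y, ψ y • (f y * a) ∂μ := by
  have h := integral_conj_of_mem_beurlingCenter hw hf (ψ := fun y => ψ (t * y * t⁻¹))
    (by fun_prop)
    (hψ'.comp_homeomorph ((Homeomorph.mulLeft t).trans (Homeomorph.mulRight t⁻¹))) a 1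
  rw [integral_conj_of_mem_beurlingCenter hw hf hψ hψ' a t]
  simpa using h

variable [CompleteSpace A]

/-- Conjugations multiply `f a` by constants, for every central `f` and every `a`. -/
theorem exists_conj_ae_eq_smul_of_mem_beurlingCenter (hw : IsWeight w) {f : BeurlingSpace μ w A}
    (hf : f ∈ beurlingCenter μ w A) (a : A) (t : G) :
    ∃ c : ℝ, ∀ᵐ y ∂μ, f (t * y * t⁻¹) * a = c • (f y * a) := by
  obtain ⟨d, hd⟩ := exists_map_conj_eq_smul μ t
  have hsm : StronglyMeasurable fun y => f y * a := (Lp.stronglyMeasurable f).mul_const a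
  have hi : Integrable (fun y => f y * a) (weightedMeasure μ w) :=
    integrable_nonUnital_mul_const (L1.integrable_coeFn f) a
  have hit := hw.integrable_conj hsm hi t
  have hsmt : StronglyMeasurable fun y => f (t * y * t⁻¹) * a :=
    hsm.comp_measurable (measurableEmbedding_conj t).measurable
  have hsub : Integrable (fun y => f (t * y * t⁻¹) * a - (d : ℝ) • (f y * a))
    (weightedMeasure μ w) := hit.sub (hi.smul (d : ℝ))
  have hψi : ∀ {F : G → A}, StronglyMeasurable F → Integrable F (weightedMeasure μ w) →
      ∀ ψ : G → ℝ, Continuous ψ → HasCompactSupport ψ → Integrable (fun y => ψ y • F y) μ :=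
    fun hF hFi ψ hψ hψ' =>
    integrable_hasCompactSupport_smul (fun K hK => hw.integrableOn_isCompact hF hFi hK) hψ hψ'
  -- The constant is the Haar factor of conjugation by `t`: `∫ ψ(y) f(tyt⁻¹)a dy = d ∫ ψ(t⁻¹yt)
  -- f(y)a dy = d ∫ ψ(y) f(y)a dy`.
  refine ⟨d, ?_⟩
  have := hw.ae_eq_zero_of_forall_isCompact hsub fun K hK =>
    ae_restrict_eq_zero_of_integral_hasCompactSupport_smul
      (fun K hK => hw.integrableOn_isCompact (hsmt.sub (hsm.const_smul (d : ℝ))) hsub hK)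
      (fun ψ hψ hψ' => ?_) hK
  · exact this.mono fun y hy => sub_eq_zero.1 hy
  · have h1 := integral_conj_eq_smul hd fun y => ψ (t⁻¹ * y * t) • (f y * a)
    have h2 := integral_conj_invariant_of_mem_beurlingCenter hw hf hψ hψ' a t⁻¹
    simp only [inv_inv] at h2
    rw [h2] at h1
    have e : ∀ y, t⁻¹ * (t * y * t⁻¹) * t = y := fun y => by group
    simp only [e] at h1
    have h3 : ∀ y, ψ y • (f (t * y * t⁻¹) * a - (d : ℝ) • (f y * a))
        = ψ y • (f (t * y * t⁻¹) * a) - (d : ℝ) • (ψ y • (f y * a)) := fun y => by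
      rw [smul_sub, smul_comm]
    refine (integral_congr_ae (.of_forall h3)).trans ?_
    refine (integral_sub (hψi hsmt hit ψ hψ hψ')
      ((hψi hsm hi ψ hψ hψ').smul (d : ℝ))).trans ?_
    simp only [Pi.smul_apply]
    rw [h1, integral_smul, sub_self]

/-- If a central `f` is annihilated by right multiplications, then also by left ones. -/
theorem ae_const_mul_eq_zero_of_mem_beurlingCenter (hw : IsWeight w) {f : BeurlingSpace μ w A}
    (hf : f ∈ beurlingCenter μ w A) {a : A} (h : ∀ᵐ y ∂μ, f y * a = 0) :
    ∀ᵐ y ∂μ, a * f y = 0 := by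
  have hsm : StronglyMeasurable fun y => a * f y := (Lp.stronglyMeasurable f).const_mul a
  have hi : Integrable (fun y => a * f y) (weightedMeasure μ w) :=
    integrable_nonUnital_const_mul (L1.integrable_coeFn f) a
  refine hw.ae_eq_zero_of_forall_isCompact hi fun K hK => ?_
  -- Centrality controls `a * f y` only through `μ.inv`, so vanishing is proved there and
  -- transferred to `μ`.
  refine ((absolutelyContinuous_inv μ).restrict K).ae_eq
    (ae_restrict_eq_zero_of_integral_hasCompactSupport_smul
      (fun K hK => integrableOn_inv μ hK (hw.integrableOn_isCompact hsm hi hK))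
      (fun ψ hψ hψ' => ?_) hK)
  have h1 := integral_conj_of_mem_beurlingCenter hw hf hψ hψ' a 1
  simp only [one_mul, inv_one, mul_one] at h1
  rw [← h1]
  exact (integral_congr_ae (h.mono fun y hy => by simp [hy])).trans (integral_zero _ _)

/-- A central `f` annihilated by right multiplications is zero. -/
theorem eq_zero_of_mem_beurlingCenter_of_ae_mul_eq_zero (hw : IsWeight w)
    {ι : Type*} [Preorder ι] [IsDirectedOrder ι] [Nonempty ι]
    {a : ι → A} (ha : IsBoundedCenterApproxIdentity a) {f : BeurlingSpace μ w A}
    (hf : f ∈ beurlingCenter μ w A) (h : ∀ a : A, ∀ᵐ y ∂μ, f y * a = 0) : f = 0 := by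
  have hi := L1.integrable_coeFn f
  have hac := weightedMeasure_absolutelyContinuous μ w
  have hright : ∀ (s : Set G) (b : A), (∫ y in s, f y ∂weightedMeasure μ w) * b = 0 := by
    intro s b
    have h1 := ((ContinuousLinearMap.mul ℝ A).flip b).integral_comp_comm hi.integrableOn (μ :=
      (weightedMeasure μ w).restrict s)
    simp only [ContinuousLinearMap.flip_apply, ContinuousLinearMap.mul_apply'] at h1
    rw [← h1]
    exact (integral_congr_ae (ae_restrict_of_ae (hac.ae_le (h b)))).trans (integral_zero _ _)
  have hleft : ∀ (s : Set G) (b : A), b * (∫ y in s, f y ∂weightedMeasure μ w) = 0 := by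
    intro s b
    have h1 := (ContinuousLinearMap.mul ℝ A b).integral_comp_comm hi.integrableOn (μ :=
      (weightedMeasure μ w).restrict s)
    simp only [ContinuousLinearMap.mul_apply'] at h1
    rw [← h1]
    exact (integral_congr_ae (ae_restrict_of_ae (hac.ae_le
      (ae_const_mul_eq_zero_of_mem_beurlingCenter hw hf (h b))))).trans (integral_zero _ _)
  rw [Lp.eq_zero_iff_ae_eq_zero]
  refine hi.ae_eq_zero_of_forall_setIntegral_eq_zero fun s _ _ => ?_
  -- The set integral is central because both products with any `b` are zero; then `a i * z = 0`
  -- tends to `z`.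
  have hz : ∫ y in s, f y ∂weightedMeasure μ w ∈ Set.center A := by
    rw [Semigroup.mem_center_iff]
    intro b
    rw [hleft, hright]
  have := ha.2 _ hz
  simp only [hleft] at this
  exact (tendsto_nhds_unique this tendsto_const_nhds)

end Convolution

theorem mainTheorem4
    {G : Type*} [Group G] [TopologicalSpace G] [IsTopologicalGroup G] [LocallyCompactSpace G]
    [T2Space G] [MeasurableSpace G] [BorelSpace G]
    (μ : Measure G) [μ.IsHaarMeasure] [μ.Regular]
    (w : G → ℝ) (hw : IsWeight w)
    (hw' : (∀ x y : G, IsConj x y → w x = w y) ∨ (∀ x : G, 1 ≤ w x))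
    {A : Type*} [NonUnitalNormedRing A] [NormedSpace ℂ A] [IsScalarTower ℂ A A]
    [SMulCommClass ℂ A A] [CompleteSpace A]
    {ι : Type*} [Preorder ι] [IsDirectedOrder ι] [Nonempty ι]
    (a : ι → A) (ha : IsBoundedCenterApproxIdentity a)
    (hZ : ∃ f ∈ beurlingCenter μ w A, f ≠ 0) :
    IsINGroup G := by
  obtain ⟨f, hf, hf0⟩ := hZ
  obtain ⟨b, hb⟩ : ∃ b : A, ¬ ∀ᵐ y ∂μ, f y * b = 0 := by
    by_contra! h
    exact hf0 (eq_zero_of_mem_beurlingCenter_of_ae_mul_eq_zero hw ha hf h)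
  have hi := hw.integrable_weightedMeasure_iff.1
    (integrable_nonUnital_mul_const (L1.integrable_coeFn f) b)
  rcases hw' with hconj | hone
  -- For a class function `w`, the weighted norm of `f b` is integrable and still scales under
  -- conjugation.
  · refine isINGroup_of_integrable_conj μ hi.norm (fun h => hb (h.mono fun y hy => ?_)) fun t => ?_
    · exact (smul_eq_zero.1 (norm_eq_zero.1 hy)).resolve_left (hw.pos y).ne'
    · obtain ⟨c, hc⟩ := exists_conj_ae_eq_smul_of_mem_beurlingCenter hw hf b t
      refine ⟨|c|, hc.mono fun y hy => ?_⟩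
      rw [hy, ← hconj y (t * y * t⁻¹) (isConj_iff.2 ⟨t, rfl⟩), smul_comm, norm_smul c,
        Real.norm_eq_abs]
  -- For `w ≥ 1` the weight can be dropped: `‖f y * b‖ ≤ w y * ‖f y * b‖` is already integrable.
  · refine isINGroup_of_integrable_conj (h := fun y => ‖f y * b‖) μ (hi.norm.mono
      ((Lp.stronglyMeasurable f).mul_const b).norm.aestronglyMeasurable
      (.of_forall fun y => ?_)) (fun h => hb (h.mono fun y hy => norm_eq_zero.1 hy)) fun t => ?_
    · rw [norm_norm, norm_norm, norm_smul, Real.norm_of_nonneg (hw.pos y).le]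
      exact le_mul_of_one_le_left (norm_nonneg _) (hone y)
    · obtain ⟨c, hc⟩ := exists_conj_ae_eq_smul_of_mem_beurlingCenter hw hf b t
      refine ⟨|c|, hc.mono fun y hy => ?_⟩
      simp only [hy, norm_smul, Real.norm_eq_abs]
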